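/- Fix a number $N\ge 2$ of players. A game $G=(A,u)$ consists of finite nonempty action sets $A_1,\dots,A_N$ and payoff functions $u_i\colon A=\prod_j A_j\to\mathbb R$. For a mixed strategy profile $p\in\prod_j\Delta A_j$, a player $i$ and an action $a_i\in A_i$, let $u_i(a_i,p_{-i})$ denote the lottery (finitely supported probability distribution on $\mathbb R$) of player $i$'s payoff when $i$ plays $a_i$ and the other players independently play according to $p_{-i}$. For a lottery $X$ and $a\in\mathbb R\setminus\{0\}$ put $K_a[X]=\frac1a\log\mathbb E[e^{aX}]$; moreover $K_0[X]=\mathbb E[X]$, and $K_{-\infty}[X]$ and $K_{+\infty}[X]$ are the minimum and the maximum of the support of $X$. Let $\mu$ be a Borel probability measure on $\overline{\mathbb R}=\mathbb R\cup\{-\infty,+\infty\}$, and let $\Phi[X]=\int_{\overline{\mathbb R}}K_a[X]\,\mathrm d\mu(a)$ be the corresponding monotone additive statistic. A profile $p$ is a $\mathrm{Nash}_\Phi$ equilibrium of $G$ if $\operatorname{supp}p_i\subseteq\operatorname{argmax}_{a_i\in A_i}\Phi[u_i(a_i,p_{-i})]$ for all $i$; for $\lambda\ge0$ it is an $\mathrm{LQRE}_{\lambda\Phi}$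 equilibrium if for all $i$ and $a_i\in A_i$ $$p_i(a_i)=\frac{\exp(\lambda\Phi[u_i(a_i,p_{-i})])}{\sum_{b\in A_i}\exp(\lambda\Phi[u_i(b,p_{-i})])}.$$ Then: 1. Every game has an $\mathrm{LQRE}_{\lambda\Phi}$ equilibrium for every $\lambda\ge0$. 2. Every game has a $\mathrm{Nash}_\Phi$ equilibrium if and only if $\mu(\{-\infty\})=\mu(\{+\infty\})=0$. 3. If $\varepsilon=\mu(\{-\infty\})+\mu(\{+\infty\})>0$, then the following game has no $\mathrm{Nash}_\Phi$ equilibrium: players $1$ and $2$ have action sets $\{a_1,b_1\}$ and $\{a_2,b_2\}$ and payoffs $(u_1,u_2)$ equal to $(1+\frac1\varepsilon,0)$ at $(a_1,a_2)$, $(0,1)$ at $(a_1,b_2)$, $(-\frac1\varepsilon,1)$ at $(b_1,a_2)$ and $(1,0)$ at $(b_1,b_2)$, and every other player has a single action and payoff $0$. -/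

import Mathlib

universe u

noncomputable section

/-- A lottery: a finitely supported probability distribution on the real line. -/
structure Lottery where
  /-- the probability of each outcome -/
  prob : ℝ →₀ ℝ
  nonneg : ∀ x, 0 ≤ prob x
  total : ∑ x ∈ prob.support, prob x = 1

namespace Lottery

theorem support_nonempty (X : Lottery) : X.prob.support.Nonempty := by
  by_contra h
  have := X.total
  rw [Finset.not_nonempty_iff_eq_empty.mp h] at this
  simp at this

/-- The expectation of `f (X)`. -/
def expect (X : Lottery) (f : ℝ → ℝ) : ℝ :=
  ∑ x ∈ X.prob.support, X.prob x * f x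

/-- The normalized cumulant generating function `K_a[X] = (1/a) log E[exp(a X)]`, extended to
`a = 0` by the expectation, to `a = -∞` by the minimum of the support of `X` and to `a = +∞` by
its maximum. -/
def K (a : EReal) (X : Lottery) : ℝ :=
  match a with
  | ⊥ => X.prob.support.min' X.support_nonempty
  | ⊤ => X.prob.support.max' X.support_nonempty
  | (a : ℝ) =>
      if a = 0 then X.expect (fun x => x)
      else 1 / a * Real.log (X.expect (fun x => Real.exp (a * x)))

/-- The statistic `Φ = ∫ K_a dμ(a)`. -/
def mixK (μ : MeasureTheory.Measure EReal) (X : Lottery) : ℝ :=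
  ∫ a, K a X ∂μ

end Lottery

/-- A finite normal form game between `N` players. -/
structure Game (N : ℕ) where
  /-- the actions of each player -/
  A : Fin N → Type u
  [fintypeA : ∀ i, Fintype (A i)]
  [nonemptyA : ∀ i, Nonempty (A i)]
  /-- `payoff i a` is the payoff of player `i` at the action profile `a` -/
  payoff : Fin N → (∀ j, A j) → ℝ

attribute [instance] Game.fintypeA Game.nonemptyA

namespace Game

variable {N : ℕ}

/-- A mixed strategy profile: a probability distribution on the actions of every player. -/
structure Profile (G : Game.{u} N) where
  /-- `prob i a` is the probability with which player `i` plays the action `a` -/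
  prob : ∀ i, G.A i → ℝ
  mem_simplex : ∀ i, prob i ∈ stdSimplex ℝ (G.A i)

theorem Profile.sum_prod (G : Game.{u} N) (p : G.Profile) :
    ∑ b : (∀ j, G.A j), ∏ j, p.prob j (b j) = 1 := by
  rw [← Fintype.piFinset_univ, ← Finset.prod_univ_sum]
  exact Finset.prod_eq_one fun i _ => (p.mem_simplex i).2

/-- The lottery `u_i(a_i, p_{-i})` faced by player `i` when playing `a` while the others play
according to `p`: a profile `b` is drawn from the product distribution of `p`, and the `i`-th
action in it is replaced by `a`. -/
def lottery (G : Game.{u} N) (p : G.Profile) (i : Fin N) (a : G.A i) : Lottery where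
  prob := ∑ b : (∀ j, G.A j),
    Finsupp.single (G.payoff i (Function.update b i a)) (∏ j, p.prob j (b j))
  nonneg x := by
    rw [Finsupp.finsetSum_apply]
    refine Finset.sum_nonneg fun b _ => ?_
    rw [Finsupp.single_apply]
    split_ifs
    · exact Finset.prod_nonneg fun j _ => (p.mem_simplex j).1 (b j)
    · exact le_rfl
  total := by
    change Finsupp.sum _ (fun _ w => w) = 1
    rw [← Finsupp.sum_finsetSum_index (fun _ => rfl) (fun _ _ _ => rfl)]
    simpa using p.sum_prod

/-- `p` is a `Nash_Φ` equilibrium: every action in the support of `p_i` maximizes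
`Φ[u_i(·, p_{-i})]`. -/
def IsNash (Φ : Lottery → ℝ) (G : Game.{u} N) (p : G.Profile) : Prop :=
  ∀ (i : Fin N) (a : G.A i), p.prob i a ≠ 0 →
    ∀ b : G.A i, Φ (G.lottery p i b) ≤ Φ (G.lottery p i a)

/-- `p` is an `LQRE_{lam Φ}` equilibrium: `p_i(a)` is proportional to
`exp (lam * Φ[u_i(a, p_{-i})])`. -/
def IsLQRE (Φ : Lottery → ℝ) (lam : ℝ) (G : Game.{u} N) (p : G.Profile) : Prop :=
  ∀ (i : Fin N) (a : G.A i),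
    p.prob i a = Real.exp (lam * Φ (G.lottery p i a)) /
      ∑ b : G.A i, Real.exp (lam * Φ (G.lottery p i b))

/-- The variant of matching pennies with payoffs
```
        0               1
  0   (1 + 1/ε, 0)    (0, 1)
  1   (-1/ε, 1)       (1, 0)
```
between the first two of `N ≥ 2` players; all further players have a single action and
payoff `0`. -/
def modifiedPennies (N : ℕ) (hN : 2 ≤ N) (ε : ℝ) : Game.{u} N where
  A i := ULift (Fin (if (i : ℕ) < 2 then 2 else 1))
  nonemptyA i := ⟨⟨⟨0, by split_ifs <;> norm_num⟩⟩⟩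
  payoff i a :=
    let x : ℕ := (a ⟨0, by omega⟩).down
    let y : ℕ := (a ⟨1, by omega⟩).down
    if (i : ℕ) = 0 then
      if x = 0 then (if y = 0 then 1 + 1 / ε else 0) else (if y = 0 then -(1 / ε) else 1)
    else if (i : ℕ) = 1 then (if x = y then 0 else 1)
    else 0

end Game

end

/-! The statistic `Φ` is an average of the `K_a`. For real `a` the value `K_a[u_i(a_i, p_{-i})]` is
continuous in `p`; `K_{±∞}` depends only on the support of the lottery, which jumps when a
probability reaches `0`.

Logit responses have full support, and all full-support profiles give an action the same lottery
support. So `K_{±∞}` may be frozen at those values (`truncK`). The modified response is continuous,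
Brouwer's theorem gives a fixed point, and as this point has full support, the frozen values are the
true ones (`exists_isLQRE`). If `μ` does not charge `±∞`, then `Φ` itself is continuous and a limit
of logit equilibria as `λ → ∞` is Nash (`exists_isNash`).

Conversely, let `ε > 0` be the mass at `±∞`. In the modified pennies game, as soon as the first
column is played with positive probability, the first row wins by at least `1/ε` in minimum and
maximum and loses at most `1` in `K_a` for real `a`. Its net advantage is at least `ε · (1/ε) - (1 -
ε) = ε` (`mixK_lt_mixK`). Best responses then cycle as in matching pennies, but without a mixed way
out.

Brouwer's theorem is derived from Scarf's combinatorial lemma, applied to the lattice points of a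
simplex. -/

noncomputable section

/-! ### Scarf's lemma. -/

namespace Scarf

variable {V I R : Type*} [LinearOrder R]

/-- A finite set `σ` is dominant for the family of rankings `r` if every `y` lies below all of `σ`
in at least one of the rankings. -/
def IsDominant (r : I → V → R) (σ : Finset V) : Prop :=
  ∀ y, ∃ i, ∀ x ∈ σ, r i y ≤ r i x

theorem IsDominant.mono {r : I → V → R} {σ τ : Finset V} (h : IsDominant r σ) (hτ : τ ⊆ σ) :
    IsDominant r τ := fun y => (h y).imp fun _ hi x hx => hi x (hτ hx)

variable [DecidableEq V] [Fintype I] [DecidableEq I]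

/-- A set with `|I|` elements which is not fully coloured has an even number of facets with set of
colours `I \ {i₀}`. -/
theorem even_card_facets (c : V → I) (i₀ : I) (D : Finset (Finset V)) (σ : Finset V)
    (hσ : σ.card = Fintype.card I) (hc : σ.image c ≠ Finset.univ)
    (hD : ∀ τ, τ ⊆ σ → (τ ∈ D ↔ τ.card + 1 = Fintype.card I ∧
      τ.image c = Finset.univ.erase i₀)) :
    Even (D.filter (· ⊆ σ)).card := by
  rcases (D.filter (· ⊆ σ)).eq_empty_or_nonempty with h | ⟨τ, hτ⟩
  · simp [h]
  obtain ⟨hτD, hτσ⟩ := Finset.mem_filter.1 hτ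
  obtain ⟨hτcard, hτc⟩ := (hD τ hτσ).1 hτD
  have hfacet : ∀ ρ ⊆ σ, ρ.card + 1 = Fintype.card I → ∃ x ∈ σ, σ.erase x = ρ := by
    intro ρ hρ hcard
    obtain ⟨x, hx, hxρ⟩ := Finset.exists_mem_notMem_of_card_lt_card
      (show ρ.card < σ.card by omega)
    refine ⟨x, hx, (Finset.eq_of_subset_of_card_le ?_ ?_).symm⟩
    · intro w hw
      exact Finset.mem_erase.2 ⟨fun h => hxρ (h ▸ hw), hρ hw⟩
    · rw [Finset.card_erase_of_mem hx]
      omega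
  obtain ⟨x, hx, rfl⟩ := hfacet τ hτσ hτcard
  have himg : σ.image c = insert (c x) ((σ.erase x).image c) := by
    rw [← Finset.image_insert, Finset.insert_erase hx]
  -- The vertex `x` missing from the facet repeats a colour, that of some `z` in the facet; the two
  -- facets sought omit `x` and `z` respectively.
  have hxi : c x ≠ i₀ := by
    intro h
    apply hc
    rw [himg, hτc, h, Finset.insert_erase (Finset.mem_univ _)]
  have hσc : σ.image c = Finset.univ.erase i₀ := by
    rw [himg, hτc, Finset.insert_eq_of_mem (by simp [hxi])]
  obtain ⟨z, hz, hzx⟩ := Finset.mem_image.1 (show c x ∈ (σ.erase x).image c by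
    rw [hτc]; simp [hxi])
  obtain ⟨hne, hzσ⟩ := Finset.mem_erase.1 hz
  have herase : ∀ a b, a ∈ σ → b ∈ σ → a ≠ b → c a = c b →
      (σ.erase a).image c = σ.image c := by
    intro a b ha hb hab hcab
    refine Finset.Subset.antisymm (Finset.image_subset_image (Finset.erase_subset _ _)) ?_
    intro i hi
    obtain ⟨w, hw, rfl⟩ := Finset.mem_image.1 hi
    by_cases hwa : w = a
    · subst hwa
      exact Finset.mem_image.2 ⟨b, Finset.mem_erase.2 ⟨hab.symm, hb⟩, hcab.symm⟩
    · exact Finset.mem_image_of_mem c (Finset.mem_erase.2 ⟨hwa, hw⟩)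
  have hpair : D.filter (· ⊆ σ) = {σ.erase x, σ.erase z} := by
    ext ρ
    rw [Finset.mem_filter, Finset.mem_insert, Finset.mem_singleton]
    constructor
    · rintro ⟨hρD, hρσ⟩
      obtain ⟨hρcard, hρc⟩ := (hD ρ hρσ).1 hρD
      obtain ⟨w, hw, rfl⟩ := hfacet ρ hρσ hρcard
      by_contra! h
      have hwx : w ≠ x := fun e => h.1 (by rw [e])
      have hwz : w ≠ z := fun e => h.2 (by rw [e])
      -- Any other facet keeps both `x` and `z`, although it has as many colours as elements.
      have hinj : Set.InjOn c ((σ.erase w : Finset V) : Set V) := by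
        apply Finset.injOn_of_card_image_eq
        rw [hρc, Finset.card_erase_of_mem (Finset.mem_univ _), Finset.card_univ]
        omega
      exact hne (hinj (by simp [hwz.symm, hzσ]) (by simp [hwx.symm, hx]) hzx)
    · rintro (rfl | rfl)
      · exact ⟨hτD, hτσ⟩
      · refine ⟨(hD _ (Finset.erase_subset _ _)).2 ⟨?_, ?_⟩, Finset.erase_subset _ _⟩
        · rw [Finset.card_erase_of_mem hzσ, ← Finset.card_erase_of_mem hx]
          exact hτcard
        · rw [herase z x hzσ hx hne hzx, hσc]
  rw [hpair, Finset.card_pair]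
  · exact even_two
  · intro h
    have : z ∈ σ.erase x := hz
    rw [h] at this
    simp at this

variable [Fintype V]

/-- A dominant set with `|I| - 1` elements, one of which is not among the slack elements `v i`, is
contained in exactly two dominant sets with `|I|` elements. -/
theorem exists_two_dominant_insert {r : I → V → R} (hr : ∀ i, Function.Injective (r i))
    {v : I → V} (hv : ∀ i j x, j ≠ i → x ∉ Set.range v → r i x < r i (v j))
    {τ : Finset V} (hτ : IsDominant r τ) (hcard : τ.card + 1 = Fintype.card I)
    {t : V} (ht : t ∈ τ) (htv : t ∉ Set.range v) :
    ∃ y z, y ≠ z ∧ y ∉ τ ∧ z ∉ τ ∧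
      ∀ x, x ∉ τ → (IsDominant r (insert x τ) ↔ x = y ∨ x = z) := by
  have hex : ∀ i, ∃ m ∈ τ, ∀ x ∈ τ, r i m ≤ r i x := fun i =>
    Finset.exists_min_image τ (r i) ⟨t, ht⟩
  choose m hm hmin using hex
  have hmeq : ∀ i, ∀ y ∈ τ, (∀ x ∈ τ, r i y ≤ r i x) → m i = y := fun i y hy h =>
    hr i (le_antisymm (hmin i y hy) (h _ (hm i)))
  have hinj : ∀ k, τ ⊆ (Finset.univ.erase k).image m →
      Set.InjOn m ((Finset.univ.erase k : Finset I) : Set I) := by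
    intro k hk
    apply Finset.injOn_of_card_image_eq
    apply le_antisymm Finset.card_image_le
    rw [Finset.card_erase_of_mem (Finset.mem_univ _), Finset.card_univ, ← hcard]
    simpa using Finset.card_le_card hk
  -- Dominance of `τ`, tested on its own elements, says that each of them is the minimum of some
  -- ranking. As there is one more ranking than elements, exactly one pair `i`, `j` shares its
  -- minimum.
  have hsurj : ∀ y ∈ τ, ∃ i, m i = y := fun y hy => by
    obtain ⟨i, hi⟩ := hτ y
    exact ⟨i, hmeq i y hy hi⟩
  obtain ⟨i, -, j, -, hij, hmij⟩ := Finset.exists_ne_map_eq_of_card_lt_of_maps_to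
    (s := (Finset.univ : Finset I)) (t := τ) (f := m) (by rw [Finset.card_univ]; omega)
    (fun i _ => hm i)
  have hsub : ∀ k l, k ≠ l → m k = m l → τ ⊆ (Finset.univ.erase k).image m := by
    intro k l hkl hmkl y hy
    obtain ⟨a, rfl⟩ := hsurj y hy
    by_cases h : a = k
    · subst h
      exact Finset.mem_image.2 ⟨l, by simp [hkl.symm], hmkl.symm⟩
    · exact Finset.mem_image.2 ⟨a, by simp [h], rfl⟩
  have hpair : ∀ k, Set.InjOn m ((Finset.univ.erase k : Finset I) : Set I) → k = i ∨ k = j := by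
    intro k hk
    by_contra! h
    exact hij (hk (by simp [h.1.symm]) (by simp [h.2.symm]) hmij)
  -- A new element must become the minimum in one ranking `k` and leave the other minima unchanged,
  -- so it lies in `M k`; dominance forces it to be the best element of `M k` in ranking `k`. `M k`
  -- contains `v k` because `τ` has the non-slack element `t`.
  let M : I → Finset V := fun k => Finset.univ.filter fun y => ∀ l, l ≠ k → r l (m l) < r l y
  have hM : ∀ k y, y ∈ M k ↔ ∀ l, l ≠ k → r l (m l) < r l y := fun k y => by simp [M]
  have hbest : ∀ k, ∃ y ∈ M k, ∀ z ∈ M k, r k z ≤ r k y := fun k =>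
    Finset.exists_max_image (M k) (r k)
      ⟨v k, (hM _ _).2 fun l hl => (hmin l t ht).trans_lt (hv l k t hl.symm htv)⟩
  choose y hyM hymax using hbest
  have hydom : ∀ k, IsDominant r (insert (y k) τ) := by
    intro k z
    by_cases hz : z ∈ M k
    · obtain ⟨l, hl⟩ := hτ z
      have hlk : l = k := by
        by_contra hne
        exact absurd (hl _ (hm l)) (not_le.2 ((hM k z).1 hz l hne))
      subst hlk
      exact ⟨l, Finset.forall_mem_insert _ _ _ |>.2 ⟨hymax l z hz, hl⟩⟩
    · rw [hM] at hz
      push Not at hz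
      obtain ⟨l, hlk, hl⟩ := hz
      exact ⟨l, Finset.forall_mem_insert _ _ _ |>.2
        ⟨hl.trans ((hM _ _).1 (hyM k) l hlk).le, fun x hx => hl.trans (hmin l x hx)⟩⟩
  have hynot : ∀ k l, k ≠ l → m k = m l → y k ∉ τ := by
    intro k l hkl hmkl hy
    obtain ⟨a, ha⟩ := hsurj _ hy
    have h := (hM _ _).1 (hyM k)
    by_cases hak : a = k
    · have := h l hkl.symm
      rw [← ha, hak, hmkl] at this
      exact lt_irrefl _ this
    · have := h a hak
      rw [← ha] at this
      exact lt_irrefl _ this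
  refine ⟨y i, y j, ?_, hynot i j hij hmij, hynot j i hij.symm hmij.symm, ?_⟩
  -- A common value would lie above the minimum of `τ` in every ranking, against dominance of `τ`.
  · intro heq
    obtain ⟨l, hl⟩ := hτ (y i)
    have := hl _ (hm l)
    by_cases hli : l = i
    · have h := (hM _ _).1 (hyM j) l (by rw [hli]; exact hij)
      rw [← heq] at h
      exact absurd this (not_le.2 h)
    · exact absurd this (not_le.2 ((hM _ _).1 (hyM i) l hli))
  · intro x hx
    constructor
    · intro hdom
      obtain ⟨k, hk⟩ := hdom x
      -- In ranking `k` the new element `x` is the minimum, so the elements of `τ` are minima of the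
      -- other rankings. Hence `m` is injective off `k`, which leaves only `k = i` or `k = j`.
      have hwit : ∀ w ∈ τ, ∃ l, l ≠ k ∧ m l = w ∧ r l w ≤ r l x := by
        intro w hw
        obtain ⟨l, hl⟩ := hdom w
        refine ⟨l, ?_, hmeq l w hw fun a ha => hl a (Finset.mem_insert_of_mem ha),
          hl x (Finset.mem_insert_self _ _)⟩
        rintro rfl
        have : w = x := hr l (le_antisymm (hl x (Finset.mem_insert_self _ _))
          (hk w (Finset.mem_insert_of_mem hw)))
        exact hx (this ▸ hw)
      have hkinj := hinj k fun w hw => by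
        obtain ⟨l, hl, hml, -⟩ := hwit w hw
        exact Finset.mem_image.2 ⟨l, by simp [hl], hml⟩
      have hxM : x ∈ M k := (hM _ _).2 fun l hl => by
        obtain ⟨l', hl', hml, hle⟩ := hwit (m l) (hm l)
        have : l' = l := hkinj (by simp [hl']) (by simp [hl]) hml
        subst this
        refine lt_of_le_of_ne hle fun h => hx ?_
        rw [← hr l' h]
        exact hm l'
      have hxy : x = y k := by
        obtain ⟨l, hl⟩ := hdom (y k)
        have hlk : l = k := by
          by_contra hne
          exact absurd (hl _ (Finset.mem_insert_of_mem (hm l)))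
            (not_le.2 ((hM _ _).1 (hyM k) l hne))
        subst hlk
        exact hr l (le_antisymm (hymax l x hxM) (hl x (Finset.mem_insert_self _ _)))
      rcases hpair k hkinj with rfl | rfl
      · exact Or.inl hxy
      · exact Or.inr hxy
    · rintro (rfl | rfl)
      · exact hydom i
      · exact hydom j

/-- The slack elements other than `v i₀` are contained in exactly one dominant set
with `|I|` elements. -/
theorem existsUnique_dominant_insert_slack {r : I → V → R} (hr : ∀ i, Function.Injective (r i))
    {v : I → V} (hv₀ : ∀ i x, r i (v i) ≤ r i x)
    (hv : ∀ i j x, j ≠ i → x ∉ Set.range v → r i x < r i (v j))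
    {t : V} (htv : t ∉ Set.range v) (i₀ : I) :
    ∃ y, y ∉ (Finset.univ.erase i₀).image v ∧ ∀ x, x ∉ (Finset.univ.erase i₀).image v →
      (IsDominant r (insert x ((Finset.univ.erase i₀).image v)) ↔ x = y) := by
  classical
  obtain ⟨y, hy, hmax⟩ := Finset.exists_max_image
    (Finset.univ.filter fun x => x ∉ Set.range v) (r i₀) ⟨t, by simpa using htv⟩
  have hyv : y ∉ Set.range v := (Finset.mem_filter.1 hy).2
  have hslack : ∀ i, ∀ w, w ∉ Set.range v → ¬ r i w ≤ r i (v i) := fun i w hw h =>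
    hw ⟨i, hr i (le_antisymm (hv₀ i w) h)⟩
  refine ⟨y, fun h => ?_, fun x hx => ⟨fun hdom => ?_, ?_⟩⟩
  · obtain ⟨l, -, hl⟩ := Finset.mem_image.1 h
    exact hyv ⟨l, hl⟩
  -- A non-slack element is never below `v i` in ranking `i`, so `i₀` is the only ranking that can
  -- witness dominance; the added element is the best non-slack one there.
  · have hi : ∀ w, w ∉ Set.range v → r i₀ w ≤ r i₀ x := by
      intro w hw
      obtain ⟨i, hi⟩ := hdom w
      by_cases hii : i = i₀
      · subst hii
        exact hi x (Finset.mem_insert_self _ _)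
      · exact absurd (hi (v i) (Finset.mem_insert_of_mem
          (Finset.mem_image_of_mem v (by simp [hii])))) (hslack i w hw)
    have hxv : x ∉ Set.range v := by
      rintro ⟨l, rfl⟩
      have : l = i₀ := by
        by_contra hne
        exact hx (Finset.mem_image_of_mem v (by simp [hne]))
      subst this
      exact hslack l y hyv (hi y hyv)
    exact hr i₀ (le_antisymm (hmax x (by simpa using hxv)) (hi y hyv))
  · rintro rfl w
    by_cases hw : w ∈ Set.range v
    · obtain ⟨l, rfl⟩ := hw
      exact ⟨l, fun a _ => hv₀ l a⟩
    · refine ⟨i₀, Finset.forall_mem_insert _ _ _ |>.2 ⟨hmax w (by simpa using hw), ?_⟩⟩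
      intro a ha
      obtain ⟨l, hl, rfl⟩ := Finset.mem_image.1 ha
      exact (hv i₀ l w (by simpa using hl) hw).le

/-- **Scarf's lemma**: for every colouring extending the tautological one on the slack elements
there is a fully coloured dominant set. -/
theorem exists_dominant_image_eq_univ {r : I → V → R} (hr : ∀ i, Function.Injective (r i))
    {v : I → V} (hv₀ : ∀ i x, r i (v i) ≤ r i x)
    (hv : ∀ i j x, j ≠ i → x ∉ Set.range v → r i x < r i (v j))
    {t : V} (htv : t ∉ Set.range v) {c : V → I} (hcv : ∀ i, c (v i) = i) [Nonempty I] :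
    ∃ σ : Finset V, σ.card = Fintype.card I ∧ IsDominant r σ ∧ σ.image c = Finset.univ := by
  classical
  by_contra! hno
  obtain ⟨i₀⟩ := ‹Nonempty I›
  -- Incidences between doors and rooms are counted in two ways. Without a fully coloured room every
  -- room has an even number of doors; every door lies in two rooms, except the door `τ₀` of slack
  -- elements, which lies in one.
  let rooms : Finset (Finset V) := Finset.univ.filter fun σ =>
    σ.card = Fintype.card I ∧ IsDominant r σ
  let doors : Finset (Finset V) := Finset.univ.filter fun τ =>
    IsDominant r τ ∧ τ.card + 1 = Fintype.card I ∧ τ.image c = Finset.univ.erase i₀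
  have hrooms : ∀ σ, σ ∈ rooms ↔ σ.card = Fintype.card I ∧ IsDominant r σ := by simp [rooms]
  have hdoors : ∀ τ, τ ∈ doors ↔
      IsDominant r τ ∧ τ.card + 1 = Fintype.card I ∧ τ.image c = Finset.univ.erase i₀ := by
    simp [doors]
  have hcount := Finset.sum_card_bipartiteAbove_eq_sum_card_bipartiteBelow
    (s := doors) (t := rooms) (fun τ σ => τ ⊆ σ)
  have heven : Even (∑ σ ∈ rooms, (doors.filter (· ⊆ σ)).card) := by
    refine Finset.even_sum _ fun σ hσ => ?_
    obtain ⟨hσcard, hσdom⟩ := (hrooms σ).1 hσ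
    refine even_card_facets c i₀ doors σ hσcard (hno σ hσcard hσdom) fun τ hτ => ?_
    rw [hdoors]
    exact ⟨fun h => h.2, fun h => ⟨hσdom.mono hτ, h⟩⟩
  have habove : ∀ τ ∈ doors, ∀ S : Finset V, (∀ x ∈ S, x ∉ τ) →
      (∀ x, x ∉ τ → (IsDominant r (insert x τ) ↔ x ∈ S)) →
      (rooms.filter (τ ⊆ ·)).card = S.card := by
    intro τ hτ S hSτ hS
    obtain ⟨-, hτcard, -⟩ := (hdoors τ).1 hτ
    symm
    refine Finset.card_bij (fun x _ => insert x τ) ?_ ?_ ?_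
    · intro x hx
      rw [Finset.mem_filter, hrooms]
      exact ⟨⟨by rw [Finset.card_insert_of_notMem (hSτ x hx), hτcard], (hS x (hSτ x hx)).2 hx⟩,
        Finset.subset_insert _ _⟩
    · intro x hx y hy hxy
      have : x ∈ insert y τ := hxy ▸ Finset.mem_insert_self x τ
      exact (Finset.mem_insert.1 this).resolve_right (hSτ x hx)
    · intro σ hσ
      obtain ⟨hσ, hsub⟩ := Finset.mem_filter.1 hσ
      obtain ⟨hσcard, hσdom⟩ := (hrooms σ).1 hσ
      obtain ⟨x, hx, hxτ⟩ := Finset.exists_mem_notMem_of_card_lt_card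
        (show τ.card < σ.card by omega)
      have : insert x τ = σ := by
        refine Finset.eq_of_subset_of_card_le (Finset.insert_subset hx hsub) ?_
        rw [Finset.card_insert_of_notMem hxτ]
        omega
      exact ⟨x, (hS x hxτ).1 (this ▸ hσdom), this⟩
  let τ₀ : Finset V := (Finset.univ.erase i₀).image v
  have hvinj : Function.Injective v := Function.LeftInverse.injective hcv
  have hcardI : 0 < Fintype.card I := Fintype.card_pos_iff.2 ⟨i₀⟩
  have hτ₀card : τ₀.card + 1 = Fintype.card I := by
    rw [Finset.card_image_of_injective _ hvinj, Finset.card_erase_of_mem (Finset.mem_univ _),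
      Finset.card_univ]
    omega
  obtain ⟨y₀, hy₀, huniq⟩ := existsUnique_dominant_insert_slack hr hv₀ hv htv i₀
  have hτ₀ : τ₀ ∈ doors := by
    rw [hdoors]
    refine ⟨((huniq y₀ hy₀).2 rfl).mono (Finset.subset_insert _ _), hτ₀card, ?_⟩
    rw [Finset.image_image, show c ∘ v = id from funext hcv, Finset.image_id]
  have hodd : Odd (∑ τ ∈ doors, (rooms.filter (τ ⊆ ·)).card) := by
    rw [← Finset.add_sum_erase _ _ hτ₀]
    refine Odd.add_even ?_ (Finset.even_sum _ fun τ hτ => ?_)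
    · rw [habove τ₀ hτ₀ {y₀} (fun x hx => Finset.mem_singleton.1 hx ▸ hy₀)
        (fun x hx => (huniq x hx).trans Finset.mem_singleton.symm)]
      simp
    · obtain ⟨hne, hτ⟩ := Finset.mem_erase.1 hτ
      obtain ⟨hdom, hτcard, hτc⟩ := (hdoors τ).1 hτ
      -- A door made of slack elements only has the colours other than `i₀`, so it is `τ₀`.
      have hex : ∃ s ∈ τ, s ∉ Set.range v := by
        by_contra! hall
        refine hne (Finset.eq_of_subset_of_card_le (fun x hx => ?_) (by omega))
        obtain ⟨l, rfl⟩ := hall x hx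
        have := Finset.mem_image_of_mem c hx
        rw [hτc, hcv] at this
        exact Finset.mem_image_of_mem v this
      obtain ⟨s, hs, hsv⟩ := hex
      obtain ⟨y, z, hyz, hy, hz, hiff⟩ := exists_two_dominant_insert hr hv hdom hτcard hs hsv
      rw [habove τ hτ {y, z} (by simp [hy, hz]) (by simpa using hiff), Finset.card_pair hyz]
      exact even_two
  rw [← Nat.not_even_iff_odd] at hodd
  apply hodd
  have : ∑ τ ∈ doors, (rooms.filter (τ ⊆ ·)).card = ∑ σ ∈ rooms, (doors.filter (· ⊆ σ)).card :=
    hcount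
  rw [this]
  exact heven

end Scarf

end

noncomputable section

/-! ### Brouwer's fixed point theorem for one simplex. -/

section Brouwer

variable {I : Type*} [Fintype I] [Nonempty I]

/-- For every colouring of the points of the simplex with denominator `m` there is a point that is
close to points of all those colours `i` for which its `i`-th coordinate is not small. -/
theorem exists_lattice_point_near_colours (m : ℕ) (c : (I → ℕ) → I) :
    ∃ x : I → ℕ, ∑ j, x j = m ∧ ∀ i, x i ≤ Fintype.card I ∨
      ∃ y : I → ℕ, ∑ j, y j = m ∧ c y = i ∧
        ∀ j, x j ≤ y j + Fintype.card I ∧ y j ≤ x j + Fintype.card I := by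
  classical
  let T := {x : I → ℕ // x ∈ Finset.piAntidiag Finset.univ m}
  have : Fintype T := Finset.Subtype.fintype (Finset.piAntidiag Finset.univ m)
  have hT : ∀ x : T, ∑ j, x.1 j = m := fun x => (Finset.mem_piAntidiag.1 x.2).1
  let e := Fintype.equivFin (T ⊕ I)
  -- The shift by `1` puts every lattice point strictly above slack `i` in ranking `i`, and `m + 2`
  -- exceeds every shifted coordinate. Ties are broken by the enumeration `e`.
  let h : I → T ⊕ I → ℕ := fun i => Sum.elim (fun x => x.1 i + 1)
    (fun j => if j = i then 0 else m + 2)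
  let r : I → T ⊕ I → ℕ ×ₗ Fin (Fintype.card (T ⊕ I)) := fun i z => toLex (h i z, e z)
  have hr : ∀ i, Function.Injective (r i) := fun i y z hyz =>
    e.injective (congrArg Prod.snd (toLex.injective hyz))
  have hr_le : ∀ i y z, r i y ≤ r i z → h i y ≤ h i z := fun i y z hyz => by
    rcases Prod.Lex.toLex_le_toLex.1 hyz with h | h
    · exact h.le
    · exact h.1.le
  have hr_lt : ∀ i y z, h i y < h i z → r i y < r i z := fun i y z hyz =>
    Prod.Lex.toLex_lt_toLex.2 (Or.inl hyz)
  have hle : ∀ (x : T) i, x.1 i ≤ m := fun x i =>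
    (Finset.single_le_sum (f := x.1) (fun _ _ => Nat.zero_le _)
      (Finset.mem_univ i)).trans_eq (hT x)
  have hv₀ : ∀ i x, r i (Sum.inr i) ≤ r i x := by
    rintro i (x | j)
    · exact (hr_lt _ _ _ (by simp [h])).le
    · by_cases hj : j = i
      · rw [hj]
      · exact (hr_lt _ _ _ (by simp [h, hj])).le
  have hv : ∀ i j x, j ≠ i → x ∉ Set.range (Sum.inr : I → T ⊕ I) → r i x < r i (Sum.inr j) := by
    rintro i j (x | k) hj hx
    · apply hr_lt
      have := hle x i
      simp only [h, Sum.elim_inl, Sum.elim_inr, if_neg hj]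
      omega
    · exact absurd ⟨k, rfl⟩ hx
  obtain ⟨i₁⟩ := id ‹Nonempty I›
  let t : T := ⟨Pi.single i₁ m, Finset.mem_piAntidiag.2 ⟨by simp, by simp⟩⟩
  obtain ⟨σ, hcard, hdom, hcol⟩ := Scarf.exists_dominant_image_eq_univ hr hv₀ hv
    (t := Sum.inl t) (by simp) (c := Sum.elim (fun x => c x.1) id) (fun i => rfl)
  have hzero : ∀ (x : T) i, (∀ z ∈ σ, r i (Sum.inl x) ≤ r i z) → Sum.inr i ∉ σ := by
    intro x i hi hmem
    have := hr_le _ _ _ (hi _ hmem)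
    simp [h] at this
  have hcolour : ∀ i, Sum.inr i ∉ σ → ∃ x : T, Sum.inl x ∈ σ ∧ c x.1 = i := by
    intro i hi
    have : i ∈ σ.image (Sum.elim (fun x : T => c x.1) id) := by rw [hcol]; simp
    obtain ⟨x | j, hx, hxi⟩ := Finset.mem_image.1 this
    · exact ⟨x, hx, hxi⟩
    · exact absurd (show Sum.inr i ∈ σ from (show j = i from hxi) ▸ hx) hi
  -- Dominance over a lattice point excludes some slack element from `σ`; its colour must then come
  -- from a lattice point.
  obtain ⟨i₂, hi₂⟩ := hdom (Sum.inl t)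
  have hi₂σ := hzero t i₂ hi₂
  obtain ⟨x₀, hx₀, -⟩ := hcolour i₂ hi₂σ
  have hmin : ∀ i, ∃ x ∈ σ.toLeft, ∀ y ∈ σ.toLeft, x.1 i ≤ y.1 i := fun i =>
    Finset.exists_min_image σ.toLeft (fun x => x.1 i) ⟨x₀, Finset.mem_toLeft.2 hx₀⟩
  choose w hw hwmin using hmin
  let a : I → ℕ := fun i => if Sum.inr i ∈ σ then 0 else (w i).1 i
  have ha : ∀ x : T, Sum.inl x ∈ σ → ∀ i, a i ≤ x.1 i := by
    intro x hx i
    by_cases hi : Sum.inr i ∈ σ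
    · simp [a, hi]
    · simpa [a, hi] using hwmin i x (Finset.mem_toLeft.2 hx)
  -- Otherwise there is room for a lattice point exceeding `a` by at least `1` in every coordinate
  -- whose slack element is not in `σ`, and no ranking places it below `σ`. Thus the lower corner
  -- `a` of `σ` has almost full sum, which keeps all lattice points of `σ` within `|I|` of it.
  have hsum : m < ∑ i, a i + Fintype.card I := by
    by_contra! hlt
    let b : I → ℕ := fun i => if Sum.inr i ∈ σ then 0 else a i + 1
    have hb : ∑ i, b i ≤ m := by
      refine le_trans ?_ hlt
      rw [← Finset.card_univ, Finset.card_eq_sum_ones, ← Finset.sum_add_distrib]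
      refine Finset.sum_le_sum fun i _ => ?_
      by_cases hi : Sum.inr i ∈ σ <;> simp [b, hi]
    let y : I → ℕ := b + Pi.single i₂ (m - ∑ i, b i)
    have hy : ∑ i, y i = m := by
      simp only [y, Pi.add_apply, Finset.sum_add_distrib]
      simp
      omega
    obtain ⟨i, hi⟩ := hdom (Sum.inl ⟨y, Finset.mem_piAntidiag.2 ⟨hy, by simp⟩⟩)
    have hiσ := hzero _ i hi
    have := hr_le _ _ _ (hi _ (Finset.mem_toLeft.1 (hw i)))
    simp [h, y, b, a, hiσ] at this
    omega
  have hnear : ∀ x : T, Sum.inl x ∈ σ → ∀ i, x.1 i ≤ a i + Fintype.card I := by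
    intro x hx i
    have h1 : ∑ j ∈ Finset.univ.erase i, a j ≤ ∑ j ∈ Finset.univ.erase i, x.1 j :=
      Finset.sum_le_sum fun j _ => ha x hx j
    have h2 := Finset.add_sum_erase Finset.univ a (Finset.mem_univ i)
    have h3 := Finset.add_sum_erase Finset.univ x.1 (Finset.mem_univ i)
    have h4 := hT x
    omega
  refine ⟨x₀.1, hT x₀, fun i => ?_⟩
  by_cases hi : Sum.inr i ∈ σ
  · left
    simpa [a, hi] using hnear x₀ hx₀ i
  · right
    obtain ⟨y, hy, hyc⟩ := hcolour i hi
    refine ⟨y.1, hT y, hyc, fun j => ⟨?_, ?_⟩⟩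
    · exact (hnear x₀ hx₀ j).trans (Nat.add_le_add_right (ha y hy j) _)
    · exact (hnear y hy j).trans (Nat.add_le_add_right (ha x₀ hx₀ j) _)

/-- Each point `z` is coloured by an `i` with `z_i ≤ f(z)_i`, which exists because both coordinate
sums are `1`. On a fine lattice, some `x` has for each `i` either a tiny `x_i` or a close neighbour
of colour `i`; uniform continuity transfers the neighbour's inequality to `x`. -/
theorem stdSimplex.exists_le_add_of_continuous {f : stdSimplex ℝ I → stdSimplex ℝ I}
    (hf : Continuous f) {δ : ℝ} (hδ : 0 < δ) : ∃ x, ∀ i, x.1 i ≤ (f x).1 i + δ := by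
  classical
  have huc : UniformContinuous f := CompactSpace.uniformContinuous_of_continuous hf
  obtain ⟨η, hη, hfη⟩ := Metric.uniformContinuous_iff.1 huc (δ / 2) (by positivity)
  set n : ℝ := (Fintype.card I : ℝ)
  obtain ⟨m, hm⟩ := exists_nat_gt (max 0 (n / min (η / 2) (δ / 2)))
  have hm0 : (0 : ℝ) < m := lt_of_le_of_lt (le_max_left _ _) hm
  have hmin : 0 < min (η / 2) (δ / 2) := by positivity
  have hnm : n / m ≤ min (η / 2) (δ / 2) := by
    have := (le_max_right _ _).trans hm.le
    rw [div_le_iff₀ hmin] at this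
    rwa [div_le_iff₀ hm0, mul_comm]
  let P : (x : I → ℕ) → ∑ j, x j = m → stdSimplex ℝ I := fun x hx =>
    ⟨fun i => x i / m, fun i => by positivity, by
      rw [← Finset.sum_div, ← Nat.cast_sum, hx, div_self hm0.ne']⟩
  have hcol : ∀ z : stdSimplex ℝ I, ∃ i, z.1 i ≤ (f z).1 i := by
    intro z
    by_contra! hlt
    have := Finset.sum_lt_sum_of_nonempty Finset.univ_nonempty fun i _ => hlt i
    rw [z.2.2, (f z).2.2] at this
    exact lt_irrefl _ this
  choose c hc using hcol
  obtain ⟨x, hx, hxc⟩ := exists_lattice_point_near_colours m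
    (fun x => if hx : ∑ j, x j = m then c (P x hx) else Classical.arbitrary I)
  refine ⟨P x hx, fun i => ?_⟩
  rcases hxc i with h | ⟨y, hy, hyi, hxy⟩
  · have h1 : (P x hx).1 i ≤ n / m := by
      change (x i : ℝ) / m ≤ n / m
      gcongr
      exact Nat.cast_le.2 h
    have h2 := (f (P x hx)).2.1 i
    have := hnm.trans (min_le_right _ _)
    linarith
  · rw [dif_pos hy] at hyi
    have hcoord : ∀ j, |(P x hx).1 j - (P y hy).1 j| ≤ n / m := by
      intro j
      change |(x j : ℝ) / m - y j / m| ≤ n / m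
      rw [← sub_div, abs_div, abs_of_pos hm0]
      gcongr
      have h1 : (x j : ℝ) ≤ y j + Fintype.card I := by exact_mod_cast (hxy j).1
      have h2 : (y j : ℝ) ≤ x j + Fintype.card I := by exact_mod_cast (hxy j).2
      rw [abs_le]
      constructor <;> linarith
    have hdist : dist (P x hx) (P y hy) < η := by
      refine lt_of_le_of_lt ?_ (half_lt_self hη)
      rw [Subtype.dist_eq, dist_pi_le_iff (by positivity)]
      intro j
      exact (hcoord j).trans (hnm.trans (min_le_left _ _))
    have hfd : |(f (P x hx)).1 i - (f (P y hy)).1 i| < δ / 2 :=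
      lt_of_le_of_lt (dist_le_pi_dist (f (P x hx)).1 (f (P y hy)).1 i) (hfη hdist)
    have h1 := hc (P y hy)
    rw [hyi] at h1
    have h2 := (abs_le.1 (hcoord i)).2
    have h3 := (abs_lt.1 hfd).1
    have h4 := hnm.trans (min_le_right _ _)
    linarith

/-- **Brouwer's fixed point theorem** for the standard simplex. -/
theorem stdSimplex.exists_fixedPoint {f : stdSimplex ℝ I → stdSimplex ℝ I}
    (hf : Continuous f) : ∃ x, f x = x := by
  -- At a maximum of `g`, approximate solutions for all `δ` give `g ≥ 0`, so `x ≤ f x`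
  -- coordinatewise. Equal sums then force equality.
  let g : stdSimplex ℝ I → ℝ := fun x =>
    Finset.univ.inf' Finset.univ_nonempty fun i => (f x).1 i - x.1 i
  have hg : Continuous g := Continuous.finset_inf'_apply _ fun i _ =>
    ((continuous_apply i).comp (continuous_subtype_val.comp hf)).sub
      ((continuous_apply i).comp continuous_subtype_val)
  obtain ⟨x, -, hx⟩ := isCompact_univ.exists_isMaxOn (s := (Set.univ : Set (stdSimplex ℝ I)))
    Set.univ_nonempty hg.continuousOn
  have hgx : 0 ≤ g x := by
    refine le_of_forall_pos_lt_add fun δ hδ => ?_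
    obtain ⟨y, hy⟩ := stdSimplex.exists_le_add_of_continuous hf (half_pos hδ)
    have h1 : g y ≤ g x := hx (Set.mem_univ y)
    have h2 : -(δ / 2) ≤ g y := Finset.le_inf' _ _ fun i _ => by linarith [hy i]
    linarith
  have hle : ∀ i ∈ Finset.univ, x.1 i ≤ (f x).1 i := fun i hi => by
    have := hgx.trans (Finset.inf'_le (fun i => (f x).1 i - x.1 i) hi)
    linarith
  have heq := (Finset.sum_eq_sum_iff_of_le hle).1 (x.2.2.trans (f x).2.2.symm)
  exact ⟨x, Subtype.ext (funext fun i => (heq i (Finset.mem_univ i)).symm)⟩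

end Brouwer

/-! ### Fixed points on products of simplices. -/

section Product

variable {J : Type*} [Fintype J] [Nonempty J] {A : J → Type*} [∀ j, Fintype (A j)]
  [∀ j, Nonempty (A j)]

/-- A fixed point theorem for finite products of standard simplices. -/
theorem stdSimplex.exists_fixedPoint_pi {f : (∀ j, stdSimplex ℝ (A j)) → ∀ j, stdSimplex ℝ (A j)}
    (hf : Continuous f) : ∃ x, f x = x := by
  set n : ℝ := (Fintype.card J : ℝ)
  have hn0 : 0 < n := Nat.cast_pos.2 Fintype.card_pos
  have hA : ∀ j, (0 : ℝ) < Fintype.card (A j) := fun j => Nat.cast_pos.2 Fintype.card_pos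
  let S : stdSimplex ℝ (Σ j, A j) → J → ℝ := fun x j => ∑ a, x.1 ⟨j, a⟩
  have hSmax : ∀ x j, 0 < max (S x j) (1 / n) := fun x j => lt_max_of_lt_right (by positivity)
  -- The product embeds by `s` in one big simplex, each block having mass `1 / n`. The left inverse
  -- `ρ` of `s` tops up light blocks uniformly to mass `1 / n` before normalizing, so that it is
  -- defined and continuous even where a block has mass `0`.
  let ρ : stdSimplex ℝ (Σ j, A j) → ∀ j, stdSimplex ℝ (A j) := fun x j =>
    ⟨fun a => (x.1 ⟨j, a⟩ + (max (S x j) (1 / n) - S x j) / Fintype.card (A j)) /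
        max (S x j) (1 / n),
      fun a => div_nonneg (add_nonneg (x.2.1 _)
        (div_nonneg (sub_nonneg.2 (le_max_left _ _)) (hA j).le)) (hSmax x j).le, by
      rw [← Finset.sum_div, Finset.sum_add_distrib, Finset.sum_const, Finset.card_univ,
        nsmul_eq_mul, mul_div_cancel₀ _ (hA j).ne']
      change (S x j + _) / _ = _
      rw [add_sub_cancel, div_self (hSmax x j).ne']⟩
  let s : (∀ j, stdSimplex ℝ (A j)) → stdSimplex ℝ (Σ j, A j) := fun p =>
    ⟨fun z => (p z.1).1 z.2 / n, fun z => div_nonneg ((p z.1).2.1 _) hn0.le, by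
      rw [Fintype.sum_sigma]
      simp_rw [← Finset.sum_div]
      rw [Finset.sum_congr rfl fun j _ => (p j).2.2, Finset.sum_const, Finset.card_univ,
        nsmul_eq_mul, mul_one, div_self hn0.ne']⟩
  have hρs : ∀ p, ρ (s p) = p := by
    intro p
    have hS : ∀ j, S (s p) j = 1 / n := fun j => by
      change ∑ a, (p j).1 a / n = 1 / n
      rw [← Finset.sum_div, (p j).2.2]
    funext j
    refine Subtype.ext (funext fun a => ?_)
    change ((p j).1 a / n + (max (S (s p) j) (1 / n) - S (s p) j) / Fintype.card (A j)) /
        max (S (s p) j) (1 / n) = (p j).1 a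
    rw [hS, max_self, sub_self, zero_div, add_zero]
    field_simp
  have hcoord : ∀ z, Continuous fun x : stdSimplex ℝ (Σ j, A j) => x.1 z := fun z =>
    (continuous_apply z).comp continuous_subtype_val
  have hScont : ∀ j, Continuous fun x => S x j := fun j =>
    continuous_finsetSum _ fun a _ => hcoord ⟨j, a⟩
  have hρ : Continuous ρ := by
    refine continuous_pi fun j => Continuous.subtype_mk (continuous_pi fun a => ?_) _
    have h1 := hScont j
    exact ((hcoord ⟨j, a⟩).add (((h1.max continuous_const).sub h1).div_const _)).div
      (h1.max continuous_const) fun x => (hSmax x j).ne'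
  have hs : Continuous s := by
    refine Continuous.subtype_mk (continuous_pi fun z => ?_) _
    have : Continuous fun p : ∀ j, stdSimplex ℝ (A j) => (p z.1).1 z.2 :=
      (continuous_apply z.2).comp (continuous_subtype_val.comp (continuous_apply z.1))
    exact this.div_const n
  have : Nonempty (Σ j, A j) := ⟨⟨Classical.arbitrary J, Classical.arbitrary _⟩⟩
  obtain ⟨x, hx⟩ := stdSimplex.exists_fixedPoint (f := fun x => s (f (ρ x)))
    (hs.comp (hf.comp hρ))
  refine ⟨ρ x, ?_⟩
  -- Applying `ρ` to `s (f (ρ x)) = x` gives `f (ρ x) = ρ x`.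
  conv_rhs => rw [← hx]
  exact (hρs _).symm

end Product

end

noncomputable section

/-! ### Bounds, monotonicity and integrability of the `K_a`. -/

namespace Lottery

open MeasureTheory

theorem K_coe (a : ℝ) (X : Lottery) : K (a : EReal) X =
    if a = 0 then X.expect (fun x => x)
    else 1 / a * Real.log (X.expect (fun x => Real.exp (a * x))) := rfl

theorem K_bot_eq (X : Lottery) : K ⊥ X = X.prob.support.min' X.support_nonempty := rfl

theorem K_top_eq (X : Lottery) : K ⊤ X = X.prob.support.max' X.support_nonempty := rfl

theorem prob_pos {X : Lottery} {x : ℝ} (hx : x ∈ X.prob.support) : 0 < X.prob x :=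
  lt_of_le_of_ne (X.nonneg x) (Finsupp.mem_support_iff.1 hx).symm

theorem expect_mono {X : Lottery} {f g : ℝ → ℝ} (h : ∀ x ∈ X.prob.support, f x ≤ g x) :
    X.expect f ≤ X.expect g :=
  Finset.sum_le_sum fun x hx => mul_le_mul_of_nonneg_left (h x hx) (X.nonneg x)

theorem expect_const (X : Lottery) (c : ℝ) : X.expect (fun _ => c) = c := by
  rw [expect, ← Finset.sum_mul, X.total, one_mul]

theorem expect_pos {X : Lottery} {f : ℝ → ℝ} (hf : ∀ x, 0 < f x) : 0 < X.expect f :=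
  Finset.sum_pos (fun x hx => mul_pos (prob_pos hx) (hf x)) X.support_nonempty

theorem expect_add_const (X : Lottery) (f : ℝ → ℝ) (c : ℝ) :
    X.expect (fun x => f x + c) = X.expect f + c := by
  conv_rhs => rw [← X.expect_const c]
  simp only [expect, mul_add, Finset.sum_add_distrib]

theorem expect_mul_const (X : Lottery) (f : ℝ → ℝ) (c : ℝ) :
    X.expect (fun x => f x * c) = X.expect f * c := by
  simp only [expect, Finset.sum_mul, mul_assoc]

theorem expect_neg (X : Lottery) (f : ℝ → ℝ) : X.expect (fun x => -f x) = -X.expect f := by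
  simp [expect]

/-- If `Y + c` stochastically dominates `X`, then `K_a[X] ≤ K_a[Y] + c`. -/
theorem K_coe_le_add {X Y : Lottery} {c : ℝ}
    (h : ∀ f : ℝ → ℝ, Monotone f → X.expect f ≤ Y.expect fun x => f (x + c)) (a : ℝ) :
    K (a : EReal) X ≤ K (a : EReal) Y + c := by
  rw [K_coe, K_coe]
  split_ifs with ha
  · rw [← expect_add_const]
    exact h _ monotone_id
  have hX : 0 < X.expect fun x => Real.exp (a * x) := expect_pos fun x => Real.exp_pos _
  have hY : 0 < Y.expect fun x => Real.exp (a * x) := expect_pos fun x => Real.exp_pos _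
  have hshift : (Y.expect fun x => Real.exp (a * (x + c))) =
      (Y.expect fun x => Real.exp (a * x)) * Real.exp (a * c) := by
    rw [← expect_mul_const]
    simp only [mul_add, Real.exp_add]
  have hlog : Real.log ((Y.expect fun x => Real.exp (a * x)) * Real.exp (a * c)) =
      Real.log (Y.expect fun x => Real.exp (a * x)) + a * c := by
    rw [Real.log_mul hY.ne' (Real.exp_pos _).ne', Real.log_exp]
  have hgoal : 1 / a * Real.log (Y.expect fun x => Real.exp (a * x)) + c =
      1 / a * (Real.log (Y.expect fun x => Real.exp (a * x)) + a * c) := by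
    field_simp
  rw [hgoal, ← hlog, ← hshift]
  rcases lt_or_gt_of_ne ha with hneg | hpos
  · have hm : Monotone fun x : ℝ => -Real.exp (a * x) := fun x y hxy =>
      neg_le_neg (Real.exp_le_exp.2 (mul_le_mul_of_nonpos_left hxy hneg.le))
    have := h _ hm
    rw [expect_neg, expect_neg, neg_le_neg_iff] at this
    exact mul_le_mul_of_nonpos_left (Real.log_le_log (expect_pos fun x => Real.exp_pos _) this)
      (one_div_neg.2 hneg).le
  · have hm : Monotone fun x : ℝ => Real.exp (a * x) := fun x y hxy =>
      Real.exp_le_exp.2 (mul_le_mul_of_nonneg_left hxy hpos.le)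
    exact mul_le_mul_of_nonneg_left (Real.log_le_log hX (h _ hm)) (one_div_pos.2 hpos).le

/-- The lottery that pays `0` with certainty. -/
def zero : Lottery where
  prob := Finsupp.single 0 1
  nonneg x := by
    rw [Finsupp.single_apply]
    split_ifs <;> norm_num
  total := by
    change Finsupp.sum _ (fun _ w => w) = 1
    simp

theorem expect_zero (f : ℝ → ℝ) : zero.expect f = f 0 := by
  change Finsupp.sum (Finsupp.single 0 1) (fun x w => w * f x) = f 0
  simp

theorem K_coe_zero (a : ℝ) : K (a : EReal) zero = 0 := by
  simp [K_coe, expect_zero]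

/-- For real `a` this is stochastic domination by the sure payoff `M`, written as `zero` shifted by
`M`. -/
theorem K_le {X : Lottery} {M : ℝ} (h : ∀ x ∈ X.prob.support, x ≤ M) (a : EReal) :
    K a X ≤ M := by
  induction a with
  | bot => exact h _ (Finset.min'_mem _ _)
  | top => exact h _ (Finset.max'_mem _ _)
  | coe a =>
    have := K_coe_le_add (X := X) (Y := zero) (c := M) (fun f hf => by
      rw [expect_zero, zero_add]
      exact (expect_mono fun x hx => hf (h x hx)).trans_eq (expect_const _ _)) a
    rwa [K_coe_zero, zero_add] at this

theorem le_K {X : Lottery} {m : ℝ} (h : ∀ x ∈ X.prob.support, m ≤ x) (a : EReal) :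
    m ≤ K a X := by
  induction a with
  | bot => exact h _ (Finset.min'_mem _ _)
  | top => exact h _ (Finset.max'_mem _ _)
  | coe a =>
    have := K_coe_le_add (X := zero) (Y := X) (c := -m) (fun f hf => by
      rw [expect_zero]
      exact (expect_const X (f 0)).symm.trans_le
        (expect_mono fun x hx => hf (by linarith [h x hx]))) a
    rw [K_coe_zero] at this
    linarith

theorem measurable_K (X : Lottery) : Measurable fun a => K a X := by
  refine EReal.measurable_of_measurable_real ?_
  simp only [K_coe]
  refine Measurable.ite (measurableSet_singleton 0) measurable_const ?_
  unfold expect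
  fun_prop

theorem integrable_K (μ : Measure EReal) [IsFiniteMeasure μ] (X : Lottery) :
    Integrable (fun a => K a X) μ := by
  refine Integrable.of_bound (measurable_K X).aestronglyMeasurable (max |K ⊥ X| |K ⊤ X|)
    (Filter.Eventually.of_forall fun a => ?_)
  have h1 : K ⊥ X ≤ K a X := le_K (fun x hx => Finset.min'_le _ _ hx) a
  have h2 : K a X ≤ K ⊤ X := K_le (fun x hx => Finset.le_max' _ _ hx) a
  exact abs_le_max_abs_abs h1 h2

theorem mixK_eq_of_forall_eq (μ : Measure EReal) [IsProbabilityMeasure μ] {X : Lottery} {c : ℝ}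
    (h : ∀ x ∈ X.prob.support, x = c) : mixK μ X = c := by
  have : ∀ a, K a X = c := fun a =>
    le_antisymm (K_le (fun x hx => (h x hx).le) a) (le_K (fun x hx => (h x hx).ge) a)
  simp [mixK, this]

theorem K_bot_congr {X Y : Lottery} (h : X.prob.support = Y.prob.support) : K ⊥ X = K ⊥ Y := by
  simp only [K_bot_eq, h]

theorem K_top_congr {X Y : Lottery} (h : X.prob.support = Y.prob.support) : K ⊤ X = K ⊤ Y := by
  simp only [K_top_eq, h]

open Classical in
/-- The value of `K_a[X]` for real `a`, and prescribed values `m` and `M` at `a = -∞` and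
`a = +∞`. -/
def truncK (m M : ℝ) (a : EReal) (X : Lottery) : ℝ :=
  if a = ⊥ then m else if a = ⊤ then M else K a X

theorem measurable_truncK (m M : ℝ) (X : Lottery) : Measurable fun a => truncK m M a X :=
  Measurable.ite (measurableSet_singleton ⊥) measurable_const
    (Measurable.ite (measurableSet_singleton ⊤) measurable_const (measurable_K X))

theorem integral_truncK_self (μ : Measure EReal) (X : Lottery) :
    ∫ a, truncK (K ⊥ X) (K ⊤ X) a X ∂μ = mixK μ X := by
  unfold mixK truncK
  congr 1
  ext a
  split_ifs with h1 h2
  · rw [h1]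
  · rw [h2]
  · rfl

theorem integral_truncK_of_null {μ : Measure EReal} (hbot : μ {⊥} = 0) (htop : μ {⊤} = 0)
    (m M : ℝ) (X : Lottery) : ∫ a, truncK m M a X ∂μ = mixK μ X := by
  refine integral_congr_ae ?_
  have h1 : ∀ᵐ a ∂μ, a ≠ ⊥ := by simpa [ae_iff] using hbot
  have h2 : ∀ᵐ a ∂μ, a ≠ ⊤ := by simpa [ae_iff] using htop
  filter_upwards [h1, h2] with a ha ha'
  simp [truncK, ha, ha']

end Lottery

/-! ### Existence of logit and Nash equilibria. -/

namespace Game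

open MeasureTheory Lottery

variable {N : ℕ}

theorem lottery_expect (G : Game.{u} N) (p : G.Profile) (i : Fin N) (a : G.A i) (f : ℝ → ℝ) :
    (G.lottery p i a).expect f =
      ∑ b : (∀ j, G.A j), (∏ j, p.prob j (b j)) * f (G.payoff i (Function.update b i a)) := by
  change Finsupp.sum (∑ b : (∀ j, G.A j),
    Finsupp.single (G.payoff i (Function.update b i a)) (∏ j, p.prob j (b j)))
      (fun x w => w * f x) = _
  rw [← Finsupp.sum_finsetSum_index (fun _ => zero_mul _) (fun _ _ _ => add_mul _ _ _)]
  simp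

theorem mem_support_lottery {G : Game.{u} N} {p : G.Profile} {i : Fin N} {a : G.A i} {x : ℝ} :
    x ∈ (G.lottery p i a).prob.support ↔
      ∃ b : (∀ j, G.A j), (∀ j, p.prob j (b j) ≠ 0) ∧
        G.payoff i (Function.update b i a) = x := by
  have hnn : ∀ b ∈ (Finset.univ : Finset (∀ j, G.A j)), 0 ≤
      Finsupp.single (G.payoff i (Function.update b i a)) (∏ j, p.prob j (b j)) x := by
    intro b _
    rw [Finsupp.single_apply]
    split_ifs
    · exact Finset.prod_nonneg fun j _ => (p.mem_simplex j).1 (b j)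
    · exact le_rfl
  have : (G.lottery p i a).prob x = ∑ b : (∀ j, G.A j),
      Finsupp.single (G.payoff i (Function.update b i a)) (∏ j, p.prob j (b j)) x :=
    Finsupp.finsetSum_apply _ _ _
  rw [Finsupp.mem_support_iff, this, Ne, Finset.sum_eq_zero_iff_of_nonneg hnn]
  push Not
  refine exists_congr fun b => ?_
  rw [Finsupp.single_apply]
  simp only [Finset.mem_univ, true_and]
  constructor
  · intro h
    split_ifs at h with hx
    · exact ⟨fun j => Finset.prod_ne_zero_iff.1 h j (Finset.mem_univ j), hx⟩
    · exact absurd rfl h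
  · rintro ⟨h, hx⟩
    rw [if_pos hx]
    exact Finset.prod_ne_zero_iff.2 fun j _ => h j

/-- The profile given by a point of the product of the simplices of mixed strategies. -/
def toProfile (G : Game.{u} N) (q : ∀ i, stdSimplex ℝ (G.A i)) : G.Profile where
  prob i := (q i).1
  mem_simplex i := (q i).2

theorem abs_truncK_lottery_le (G : Game.{u} N) (i : Fin N) (a : G.A i) (m M : ℝ) :
    ∃ B, ∀ (p : G.Profile) (t : EReal), |truncK m M t (G.lottery p i a)| ≤ B := by
  let C : ℝ := ∑ b : (∀ j, G.A j), |G.payoff i b|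
  have hC : ∀ b, |G.payoff i b| ≤ C := fun b =>
    Finset.single_le_sum (f := fun b => |G.payoff i b|) (fun _ _ => abs_nonneg _)
      (Finset.mem_univ b)
  refine ⟨max |m| (max |M| C), fun p t => ?_⟩
  unfold truncK
  split_ifs
  · exact le_max_left _ _
  · exact (le_max_left _ _).trans (le_max_right _ _)
  · refine le_trans (abs_le.2 ⟨le_K (fun x hx => ?_) t, K_le (fun x hx => ?_) t⟩)
      ((le_max_right _ _).trans (le_max_right _ _))
    · obtain ⟨b, -, rfl⟩ := mem_support_lottery.1 hx
      exact (abs_le.1 (hC _)).1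
    · obtain ⟨b, -, rfl⟩ := mem_support_lottery.1 hx
      exact (abs_le.1 (hC _)).2

theorem continuous_expect_lottery (G : Game.{u} N) (i : Fin N) (a : G.A i) (f : ℝ → ℝ) :
    Continuous fun q : ∀ i, stdSimplex ℝ (G.A i) => (G.lottery (G.toProfile q) i a).expect f := by
  simp only [lottery_expect]
  refine continuous_finsetSum _ fun b _ => Continuous.mul ?_ continuous_const
  refine continuous_finsetProd _ fun j _ => ?_
  exact (continuous_apply (b j)).comp (continuous_subtype_val.comp (continuous_apply j))

theorem continuous_truncK_lottery (G : Game.{u} N) (i : Fin N) (a : G.A i) (m M : ℝ) (t : EReal) :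
    Continuous fun q : ∀ i, stdSimplex ℝ (G.A i) =>
      truncK m M t (G.lottery (G.toProfile q) i a) := by
  induction t with
  | bot => simpa [truncK] using continuous_const
  | top => simpa [truncK] using continuous_const
  | coe t =>
    simp only [truncK, EReal.coe_ne_bot, EReal.coe_ne_top, if_false, K_coe]
    split_ifs
    · exact continuous_expect_lottery G i a _
    · exact continuous_const.mul ((continuous_expect_lottery G i a _).log fun q =>
        (expect_pos fun x => Real.exp_pos _).ne')

/-- Dominated convergence: the integrand is continuous in the profile for each fixed `t`, the values
at `±∞` being constants, and a bound built from `m`, `M` and the payoffs is uniform in the profile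
and in `t`. -/
theorem continuous_integral_truncK (G : Game.{u} N) (i : Fin N) (a : G.A i) (m M : ℝ)
    (μ : Measure EReal) [IsFiniteMeasure μ] :
    Continuous fun q : ∀ i, stdSimplex ℝ (G.A i) =>
      ∫ t, truncK m M t (G.lottery (G.toProfile q) i a) ∂μ := by
  obtain ⟨B, hB⟩ := abs_truncK_lottery_le G i a m M
  exact continuous_of_dominated (fun q => (measurable_truncK m M _).aestronglyMeasurable)
    (fun q => Filter.Eventually.of_forall fun t => hB _ t) (integrable_const B)
    (Filter.Eventually.of_forall fun t => continuous_truncK_lottery G i a m M t)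

/-- Existence of quantal response equilibria for continuous evaluations of the actions. -/
theorem exists_logit_fixedPoint (G : Game.{u} N) (hN : 0 < N)
    (Ψ : ∀ i, G.A i → (∀ i, stdSimplex ℝ (G.A i)) → ℝ) (hΨ : ∀ i a, Continuous (Ψ i a)) :
    ∃ q : ∀ i, stdSimplex ℝ (G.A i), ∀ i a,
      (q i).1 a = Real.exp (Ψ i a q) / ∑ b, Real.exp (Ψ i b q) := by
  have hpos : ∀ i q, 0 < ∑ b, Real.exp (Ψ i b q) := fun i q =>
    Finset.sum_pos (fun _ _ => Real.exp_pos _) Finset.univ_nonempty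
  let f : (∀ i, stdSimplex ℝ (G.A i)) → ∀ i, stdSimplex ℝ (G.A i) := fun q i =>
    ⟨fun a => Real.exp (Ψ i a q) / ∑ b, Real.exp (Ψ i b q),
      fun a => div_nonneg (Real.exp_pos _).le (hpos i q).le, by
        rw [← Finset.sum_div, div_self (hpos i q).ne']⟩
  have hf : Continuous f := by
    refine continuous_pi fun i => Continuous.subtype_mk (continuous_pi fun a => ?_) _
    exact (hΨ i a).rexp.div (continuous_finsetSum _ fun b _ => (hΨ i b).rexp)
      fun q => (hpos i q).ne'
  have : Nonempty (Fin N) := ⟨⟨0, hN⟩⟩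
  obtain ⟨q, hq⟩ := stdSimplex.exists_fixedPoint_pi hf
  refine ⟨q, fun i a => ?_⟩
  conv_lhs => rw [← hq]

theorem support_lottery_eq {G : Game.{u} N} {p p' : G.Profile} (hp : ∀ i a, p.prob i a ≠ 0)
    (hp' : ∀ i a, p'.prob i a ≠ 0) (i : Fin N) (a : G.A i) :
    (G.lottery p i a).prob.support = (G.lottery p' i a).prob.support := by
  ext x
  simp only [mem_support_lottery, ne_eq, hp, hp', not_false_eq_true, implies_true, true_and]

theorem exists_isLQRE (G : Game.{u} N) (hN : 0 < N) (μ : Measure EReal) [IsFiniteMeasure μ]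
    (lam : ℝ) : ∃ q : ∀ i, stdSimplex ℝ (G.A i), G.IsLQRE (mixK μ) lam (G.toProfile q) := by
  -- Any full-support profile would do: it only supplies the minima and maxima at which `K_{±∞}` is
  -- frozen. The fixed point has full support too, so `hmix` recovers the true `Φ`.
  let p₀ : G.Profile := G.toProfile fun i => stdSimplex.barycenter
  have hp₀ : ∀ i a, p₀.prob i a ≠ 0 := fun i a => by
    exact (stdSimplex.barycenter_apply (𝕜 := ℝ) a).trans_ne (by positivity)
  obtain ⟨q, hq⟩ := G.exists_logit_fixedPoint hN
    (fun i a q => lam * ∫ t, truncK (K ⊥ (G.lottery p₀ i a)) (K ⊤ (G.lottery p₀ i a)) t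
      (G.lottery (G.toProfile q) i a) ∂μ)
    (fun i a => continuous_const.mul (continuous_integral_truncK G i a _ _ μ))
  have hq0 : ∀ i a, (G.toProfile q).prob i a ≠ 0 := fun i a => by
    change (q i).1 a ≠ 0
    rw [hq i a]
    exact (div_pos (Real.exp_pos _)
      (Finset.sum_pos (fun _ _ => Real.exp_pos _) Finset.univ_nonempty)).ne'
  refine ⟨q, fun i a => ?_⟩
  have hmix : ∀ b, ∫ t, truncK (K ⊥ (G.lottery p₀ i b)) (K ⊤ (G.lottery p₀ i b)) t
      (G.lottery (G.toProfile q) i b) ∂μ = mixK μ (G.lottery (G.toProfile q) i b) := fun b => by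
    rw [K_bot_congr (support_lottery_eq hp₀ hq0 i b), K_top_congr (support_lottery_eq hp₀ hq0 i b),
      integral_truncK_self]
  simp only [← hmix]
  exact hq i a

/-- Take a limit of logit equilibria with parameter `n → ∞` along a convergent subsequence. An
action that is worse than `b` in the limit has probability at most `exp (-n * gap)`, where by
continuity of `Φ` the gap tends to a positive number, so its limiting probability is `0`. -/
theorem exists_isNash (G : Game.{u} N) (hN : 0 < N) {μ : Measure EReal} [IsFiniteMeasure μ]
    (hbot : μ {⊥} = 0) (htop : μ {⊤} = 0) : ∃ p : G.Profile, G.IsNash (mixK μ) p := by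
  have hcont : ∀ i a, Continuous fun q : ∀ i, stdSimplex ℝ (G.A i) =>
      mixK μ (G.lottery (G.toProfile q) i a) := fun i a => by
    -- The frozen values `0`, `0` are arbitrary, since `±∞` are null.
    simpa only [integral_truncK_of_null hbot htop] using continuous_integral_truncK G i a 0 0 μ
  choose s hs using fun n : ℕ => G.exists_isLQRE hN μ n
  obtain ⟨q, φ, hφ, hlim⟩ := CompactSpace.tendsto_subseq s
  refine ⟨G.toProfile q, fun i a ha b => ?_⟩
  by_contra! hlt
  have hdiff : Filter.Tendsto (fun n => mixK μ (G.lottery (G.toProfile (s (φ n))) i b) -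
      mixK μ (G.lottery (G.toProfile (s (φ n))) i a)) Filter.atTop
      (nhds (mixK μ (G.lottery (G.toProfile q) i b) -
        mixK μ (G.lottery (G.toProfile q) i a))) :=
    (((hcont i b).sub (hcont i a)).tendsto q).comp hlim
  have hexp := Real.tendsto_exp_neg_atTop_nhds_zero.comp
    ((tendsto_natCast_atTop_atTop (R := ℝ).comp hφ.tendsto_atTop).atTop_mul_pos
      (sub_pos.2 hlt) hdiff)
  have hprob : Filter.Tendsto (fun n => (s (φ n) i).1 a) Filter.atTop (nhds ((q i).1 a)) :=
    ((((continuous_apply a).comp continuous_subtype_val).comp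
      (continuous_apply (A := fun i => stdSimplex ℝ (G.A i)) i)).tendsto q).comp hlim
  have hle : (q i).1 a ≤ 0 := by
    refine le_of_tendsto_of_tendsto' hprob hexp fun n => ?_
    have h := hs (φ n) i a
    change (s (φ n) i).1 a = _ at h
    rw [h]
    have hsum := Finset.single_le_sum (f := fun c => Real.exp ((φ n : ℝ) *
      mixK μ (G.lottery (G.toProfile (s (φ n))) i c))) (fun _ _ => (Real.exp_pos _).le)
      (Finset.mem_univ b)
    refine (div_le_div_of_nonneg_left (Real.exp_pos _).le (Real.exp_pos _) hsum).trans_eq ?_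
    rw [← Real.exp_sub]
    simp only [Function.comp_apply]
    congr 1
    ring
  exact ha (le_antisymm hle ((q i).2.1 a))

end Game

end

noncomputable section

/-! ### Nonexistence in the modified pennies game. -/

namespace Game

open MeasureTheory Lottery

variable {N : ℕ}

theorem Profile.exists_prob_ne_zero {G : Game.{u} N} (p : G.Profile) (i : Fin N) :
    ∃ a, p.prob i a ≠ 0 := by
  by_contra! h
  have := (p.mem_simplex i).2
  simp [h] at this

theorem K_lottery_le_add {G : Game.{u} N} (p : G.Profile) {i : Fin N} {a a' : G.A i} {c : ℝ}
    (h : ∀ b, G.payoff i (Function.update b i a) ≤ G.payoff i (Function.update b i a') + c)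
    (t : ℝ) : K (t : EReal) (G.lottery p i a) ≤ K (t : EReal) (G.lottery p i a') + c := by
  refine K_coe_le_add (fun f hf => ?_) t
  rw [lottery_expect, lottery_expect]
  exact Finset.sum_le_sum fun b _ => mul_le_mul_of_nonneg_left (hf (h b))
    (Finset.prod_nonneg fun j _ => (p.mem_simplex j).1 (b j))

/-- If `X` exceeds `Y` by `1 / ε` in the minimum and in the maximum, where `ε` is the mass of `μ`
at `±∞`, and falls short of it by at most `1` in `K_a` for real `a`, then `Φ[Y] < Φ[X]`. -/
theorem mixK_lt_mixK {μ : Measure EReal} [IsProbabilityMeasure μ] {ε : ℝ}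
    (hε : ε = μ.real {⊥} + μ.real {⊤}) (hpos : 0 < ε) {X Y : Lottery}
    (hbot : K ⊥ Y + 1 / ε ≤ K ⊥ X) (htop : K ⊤ Y + 1 / ε ≤ K ⊤ X)
    (hreal : ∀ t : ℝ, K (t : EReal) Y ≤ K (t : EReal) X + 1) : mixK μ Y < mixK μ X := by
  -- A lower bound for `K_t[X] - K_t[Y]`, equal to `1 / ε` at `±∞` and to `-1` elsewhere. Its
  -- integral is `(1 / ε + 1) * ε - 1 = ε`.
  let ψ : EReal → ℝ := fun t => ({⊥} : Set EReal).indicator (fun _ => 1 / ε + 1) t +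
    ({⊤} : Set EReal).indicator (fun _ => 1 / ε + 1) t - 1
  have hi : ∀ s : EReal, Integrable (({s} : Set EReal).indicator fun _ => 1 / ε + 1) μ :=
    fun s => (integrable_const _).indicator (measurableSet_singleton s)
  have hψ : ∫ t, ψ t ∂μ = ε := by
    change ∫ t, ((({⊥} : Set EReal).indicator (fun _ => 1 / ε + 1) +
      ({⊤} : Set EReal).indicator (fun _ => 1 / ε + 1)) t - 1) ∂μ = ε
    rw [integral_sub ((hi ⊥).add (hi ⊤)) (integrable_const _), integral_add' (hi ⊥) (hi ⊤),
      integral_indicator_const _ (measurableSet_singleton _),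
      integral_indicator_const _ (measurableSet_singleton _), ← add_smul, ← hε]
    simp only [smul_eq_mul, integral_const, probReal_univ]
    field_simp
    ring
  have hle : ∫ t, ψ t ∂μ ≤ ∫ t, (K t X - K t Y) ∂μ := by
    refine integral_mono (((hi ⊥).add (hi ⊤)).sub (integrable_const _))
      ((integrable_K μ X).sub (integrable_K μ Y)) fun t => ?_
    induction t with
    | bot => simp [ψ] at hbot ⊢; linarith
    | top => simp [ψ] at htop ⊢; linarith
    | coe t => simp [ψ]; linarith [hreal t]
  rw [hψ, integral_sub (integrable_K μ X) (integrable_K μ Y)] at hle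
  unfold mixK
  linarith

section Pennies

variable {hN : 2 ≤ N} {ε : ℝ}

/-- The number of an action in the game `modifiedPennies`. -/
def actionIndex {i : Fin N} (a : (modifiedPennies.{u} N hN ε).A i) : ℕ :=
  (ULift.down a : Fin (if (i : ℕ) < 2 then 2 else 1))

/-- The action with a given number of one of the first two players in `modifiedPennies`. -/
def pennyAction (i : Fin N) (hi : (i : ℕ) < 2) (k : Fin 2) : (modifiedPennies.{u} N hN ε).A i :=
  ULift.up (Fin.cast (if_pos hi).symm k)

theorem actionIndex_pennyAction (i : Fin N) (hi : (i : ℕ) < 2) (k : Fin 2) :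
    actionIndex (pennyAction i hi k : (modifiedPennies.{u} N hN ε).A i) = k := rfl

theorem eq_pennyAction {i : Fin N} (hi : (i : ℕ) < 2) (a : (modifiedPennies.{u} N hN ε).A i) :
    a = pennyAction i hi 0 ∨ a = pennyAction i hi 1 := by
  have hlt : actionIndex a < 2 :=
    (ULift.down a : Fin (if (i : ℕ) < 2 then 2 else 1)).isLt.trans_eq (if_pos hi)
  have hext : ∀ k : Fin 2, actionIndex a = k → a = pennyAction i hi k := fun k hk =>
    ULift.down_injective (Fin.ext hk)
  have : actionIndex a = 0 ∨ actionIndex a = 1 := by omega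
  exact this.imp (hext 0) (hext 1)

/-- The payoff of the first player in `modifiedPennies`. -/
def pennyPayoff (ε : ℝ) (x y : ℕ) : ℝ :=
  if x = 0 then (if y = 0 then 1 + 1 / ε else 0) else (if y = 0 then -(1 / ε) else 1)

variable (hN ε) in
theorem payoff_fst (b : ∀ j, (modifiedPennies.{u} N hN ε).A j) :
    (modifiedPennies.{u} N hN ε).payoff ⟨0, by omega⟩ b =
      pennyPayoff ε (actionIndex (b ⟨0, by omega⟩)) (actionIndex (b ⟨1, by omega⟩)) := rfl

variable (hN ε) in
theorem payoff_snd (b : ∀ j, (modifiedPennies.{u} N hN ε).A j) :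
    (modifiedPennies.{u} N hN ε).payoff ⟨1, by omega⟩ b =
      if actionIndex (b ⟨0, by omega⟩) = actionIndex (b ⟨1, by omega⟩) then 0 else 1 := rfl

theorem payoff_fst_update (b : ∀ j, (modifiedPennies.{u} N hN ε).A j) (k : Fin 2) :
    (modifiedPennies.{u} N hN ε).payoff ⟨0, by omega⟩
      (Function.update b ⟨0, by omega⟩ (pennyAction ⟨0, by omega⟩ (by simp) k)) =
      pennyPayoff ε k (actionIndex (b ⟨1, by omega⟩)) := by
  rw [payoff_fst, Function.update_self, actionIndex_pennyAction,
    Function.update_of_ne (by simp)]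

theorem payoff_snd_update (b : ∀ j, (modifiedPennies.{u} N hN ε).A j) (k : Fin 2) :
    (modifiedPennies.{u} N hN ε).payoff ⟨1, by omega⟩
      (Function.update b ⟨1, by omega⟩ (pennyAction ⟨1, by omega⟩ (by simp) k)) =
      if actionIndex (b ⟨0, by omega⟩) = k then 0 else 1 := by
  rw [payoff_snd, Function.update_self, actionIndex_pennyAction,
    Function.update_of_ne (by simp)]

/-- If a player never plays one of two actions, the other is the only one that is played. -/
theorem actionIndex_eq_of_prob_eq_zero {i : Fin N} (hi : (i : ℕ) < 2)
    {p : (modifiedPennies.{u} N hN ε).Profile} {k l : Fin 2} (hkl : k ≠ l)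
    (hk : p.prob i (pennyAction i hi k) = 0) {a : (modifiedPennies.{u} N hN ε).A i}
    (ha : p.prob i a ≠ 0) : actionIndex a = l := by
  have : a = pennyAction i hi k ∨ a = pennyAction i hi l := by
    have := eq_pennyAction hi a
    fin_cases k <;> fin_cases l
    · exact absurd rfl hkl
    · exact this
    · exact this.symm
    · exact absurd rfl hkl
  rcases this with rfl | rfl
  · exact absurd hk ha
  · rfl

/-- Against a pure opponent the lottery is a sure payoff, on which every `K_a` agrees; `μ` plays no
role. -/
theorem mixK_lottery_fst {μ : Measure EReal} [IsProbabilityMeasure μ]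
    {p : (modifiedPennies.{u} N hN ε).Profile} {l : Fin 2}
    (h : ∀ a, p.prob ⟨1, by omega⟩ a ≠ 0 → actionIndex a = l) (k : Fin 2) :
    mixK μ ((modifiedPennies.{u} N hN ε).lottery p ⟨0, by omega⟩
      (pennyAction ⟨0, by omega⟩ (by simp) k)) = pennyPayoff ε k l := by
  refine mixK_eq_of_forall_eq μ fun x hx => ?_
  obtain ⟨b, hb, rfl⟩ := mem_support_lottery.1 hx
  rw [payoff_fst_update, h _ (hb _)]

theorem mixK_lottery_snd {μ : Measure EReal} [IsProbabilityMeasure μ]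
    {p : (modifiedPennies.{u} N hN ε).Profile} {l : Fin 2}
    (h : ∀ a, p.prob ⟨0, by omega⟩ a ≠ 0 → actionIndex a = l) (k : Fin 2) :
    mixK μ ((modifiedPennies.{u} N hN ε).lottery p ⟨1, by omega⟩
      (pennyAction ⟨1, by omega⟩ (by simp) k)) = if l = k then 0 else 1 := by
  refine mixK_eq_of_forall_eq μ fun x hx => ?_
  obtain ⟨b, hb, rfl⟩ := mem_support_lottery.1 hx
  rw [payoff_snd_update, h _ (hb _)]
  simp only [Fin.ext_iff]

/-- If the second player plays the first column with positive probability, then the first row is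
strictly better than the second one. -/
theorem mixK_lottery_fst_lt {μ : Measure EReal} [IsProbabilityMeasure μ]
    (hε : ε = μ.real {⊥} + μ.real {⊤}) (hpos : 0 < ε)
    {p : (modifiedPennies.{u} N hN ε).Profile}
    (hp : p.prob ⟨1, by omega⟩ (pennyAction ⟨1, by omega⟩ (by simp) 0) ≠ 0) :
    mixK μ ((modifiedPennies.{u} N hN ε).lottery p ⟨0, by omega⟩
      (pennyAction ⟨0, by omega⟩ (by simp) 1)) <
    mixK μ ((modifiedPennies.{u} N hN ε).lottery p ⟨0, by omega⟩
      (pennyAction ⟨0, by omega⟩ (by simp) 0)) := by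
  have hinv : 0 < 1 / ε := by positivity
  have hmem : ∀ k : Fin 2, pennyPayoff ε k 0 ∈
      ((modifiedPennies.{u} N hN ε).lottery p ⟨0, by omega⟩
        (pennyAction ⟨0, by omega⟩ (by simp) k)).prob.support := by
    intro k
    -- Any profile of played actions, redirected to the first column, shows that this column's
    -- payoff occurs with positive probability.
    choose b hb using p.exists_prob_ne_zero
    refine mem_support_lottery.2 ⟨Function.update b ⟨1, by omega⟩
      (pennyAction ⟨1, by omega⟩ (by simp) 0), fun j => ?_, ?_⟩
    · by_cases hj : j = ⟨1, by omega⟩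
      · subst hj
        rwa [Function.update_self]
      · rw [Function.update_of_ne hj]
        exact hb j
    · rw [payoff_fst_update, Function.update_self, actionIndex_pennyAction]
      rfl
  refine mixK_lt_mixK hε hpos ?_ ?_ fun t => K_lottery_le_add p (fun b => ?_) t
  -- The minimum is at most `-1 / ε` in the second row and at least `0` in the first.
  · have h1 := Finset.min'_le _ _ (hmem 1)
    rw [← K_bot_eq] at h1
    have h2 := le_K (X := (modifiedPennies.{u} N hN ε).lottery p ⟨0, by omega⟩
      (pennyAction ⟨0, by omega⟩ (by simp) 0)) (m := 0) (fun x hx => by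
        obtain ⟨b, -, rfl⟩ := mem_support_lottery.1 hx
        rw [payoff_fst_update]
        simp only [pennyPayoff, Fin.val_zero, if_true]
        split_ifs <;> linarith) ⊥
    simp only [pennyPayoff, Fin.val_one, one_ne_zero, if_false, if_true] at h1
    linarith
  -- The maximum is at least `1 + 1 / ε` in the first row and at most `1` in the second.
  · have h1 := Finset.le_max' _ _ (hmem 0)
    rw [← K_top_eq] at h1
    have h2 := K_le (X := (modifiedPennies.{u} N hN ε).lottery p ⟨0, by omega⟩
      (pennyAction ⟨0, by omega⟩ (by simp) 1)) (M := 1) (fun x hx => by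
        obtain ⟨b, -, rfl⟩ := mem_support_lottery.1 hx
        rw [payoff_fst_update]
        simp only [pennyPayoff, Fin.val_one, one_ne_zero, if_false]
        split_ifs <;> linarith) ⊤
    simp only [pennyPayoff, Fin.val_zero, if_true] at h1
    linarith
  · rw [payoff_fst_update, payoff_fst_update]
    simp only [pennyPayoff, Fin.val_one, Fin.val_zero, one_ne_zero, if_false, if_true]
    split_ifs <;> linarith

/-- If the first column is never played, the first player answers with the second row, against which
the second player strictly prefers the first column. If it is played at all, `mixK_lottery_fst_lt`
forces the first row, against which the second player strictly prefers the second column. -/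
theorem not_isNash_modifiedPennies {μ : Measure EReal} [IsProbabilityMeasure μ]
    (hε : ε = μ.real {⊥} + μ.real {⊤}) (hpos : 0 < ε)
    (p : (modifiedPennies.{u} N hN ε).Profile) :
    ¬ (modifiedPennies.{u} N hN ε).IsNash (mixK μ) p := by
  intro hp
  have hzero : ∀ {i : Fin N} {a b : (modifiedPennies.{u} N hN ε).A i},
      mixK μ ((modifiedPennies.{u} N hN ε).lottery p i a) <
        mixK μ ((modifiedPennies.{u} N hN ε).lottery p i b) → p.prob i a = 0 :=
    fun {i a b} hlt => by
      by_contra hne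
      exact absurd (hp i a hne b) (not_le.2 hlt)
  by_cases h : p.prob ⟨1, by omega⟩ (pennyAction ⟨1, by omega⟩ (by simp) 0) = 0
  · have hsnd : ∀ a, p.prob ⟨1, by omega⟩ a ≠ 0 → actionIndex a = (1 : Fin 2) := fun a ha =>
      actionIndex_eq_of_prob_eq_zero (by simp) (by simp) h ha
    have h0 : p.prob ⟨0, by omega⟩ (pennyAction ⟨0, by omega⟩ (by simp) 0) = 0 := by
      refine hzero (b := pennyAction ⟨0, by omega⟩ (by simp) 1) ?_
      rw [mixK_lottery_fst hsnd, mixK_lottery_fst hsnd]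
      simp [pennyPayoff]
    have hfst : ∀ a, p.prob ⟨0, by omega⟩ a ≠ 0 → actionIndex a = (1 : Fin 2) := fun a ha =>
      actionIndex_eq_of_prob_eq_zero (by simp) (by simp) h0 ha
    have h1 : p.prob ⟨1, by omega⟩ (pennyAction ⟨1, by omega⟩ (by simp) 1) = 0 := by
      refine hzero (b := pennyAction ⟨1, by omega⟩ (by simp) 0) ?_
      rw [mixK_lottery_snd hfst, mixK_lottery_snd hfst]
      simp
    obtain ⟨a, ha⟩ := p.exists_prob_ne_zero ⟨1, by omega⟩
    rcases eq_pennyAction (by simp) a with rfl | rfl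
    · exact ha h
    · exact ha h1
  · have h0 := hzero (mixK_lottery_fst_lt hε hpos h)
    have hfst : ∀ a, p.prob ⟨0, by omega⟩ a ≠ 0 → actionIndex a = (0 : Fin 2) := fun a ha =>
      actionIndex_eq_of_prob_eq_zero (by simp) (by simp) h0 ha
    refine h (hzero (b := pennyAction ⟨1, by omega⟩ (by simp) 1) ?_)
    rw [mixK_lottery_snd hfst, mixK_lottery_snd hfst]
    simp

end Pennies

end Game

end

theorem mainTheorem5 (N : ℕ) (hN : 2 ≤ N) (μ : MeasureTheory.Measure EReal)
    [MeasureTheory.IsProbabilityMeasure μ] :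
    (∀ (G : Game.{u} N) (lam : ℝ), 0 ≤ lam →
      ∃ p : G.Profile, G.IsLQRE (Lottery.mixK μ) lam p) ∧
    ((∀ G : Game.{u} N, ∃ p : G.Profile, G.IsNash (Lottery.mixK μ) p) ↔
      μ {⊥} = 0 ∧ μ {⊤} = 0) ∧
    (∀ ε : ℝ, ε = μ.real {⊥} + μ.real {⊤} → 0 < ε →
      ¬ ∃ p : (Game.modifiedPennies.{u} N hN ε).Profile,
        (Game.modifiedPennies.{u} N hN ε).IsNash (Lottery.mixK μ) p) := by
  refine ⟨fun G lam _ => ?_, ⟨fun h => ?_, fun h G => G.exists_isNash (by omega) h.1 h.2⟩,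
    fun ε hε hpos ⟨p, hp⟩ => Game.not_isNash_modifiedPennies hε hpos p hp⟩
  · obtain ⟨q, hq⟩ := G.exists_isLQRE (by omega) μ lam
    exact ⟨_, hq⟩
  -- The game makes sense even if the mass at `±∞` is `0`; its equilibrium is contradictory only if
  -- that mass is positive.
  · obtain ⟨p, hp⟩ := h (Game.modifiedPennies N hN (μ.real {⊥} + μ.real {⊤}))
    have hle : μ.real {⊥} + μ.real {⊤} ≤ 0 := by
      by_contra! hpos
      exact Game.not_isNash_modifiedPennies rfl hpos p hp
    have hbot : 0 ≤ μ.real {⊥} := MeasureTheory.measureReal_nonneg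
    have htop : 0 ≤ μ.real {⊤} := MeasureTheory.measureReal_nonneg
    exact ⟨(MeasureTheory.measureReal_eq_zero_iff).1 (by linarith),
      (MeasureTheory.measureReal_eq_zero_iff).1 (by linarith)⟩
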